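/- **Theorem.** Let $d\ge 1$ and $\lambda>0$, and let $\Phi$ be a homogeneous Poisson point process of intensity $\lambda$ on $\mathbb{R}^d$. Let $V_o=\{y\in\mathbb{R}^d : \|y\|\le\|x-y\| \text{ for all } x\in\Phi\}$ be the typical Poisson–Voronoi cell (with nucleus the origin $o$), and let $R_o=\|Y\|$, where, given $\Phi$, the point $Y$ is uniformly distributed in $V_o$. Write $\upsilon_d$ for Lebesgue measure, $B_r$ for the closed ball of radius $r$ about $o$, and $\kappa_d=\pi^{d/2}/\Gamma(d/2+1)$. Then: 1. $\upsilon_d(V_o)$ and, for every $r$, $\upsilon_d(B_r\cap V_o)$ have finite second moments, $\mathbb{E}[\upsilon_d(V_o)]>0$, and the CDF of $R_o$ is $$F_{R_o}(r)=\mathbb{E}\left[\frac{\upsilon_d(B_r\cap V_o)}{\upsilon_d(V_o)}\right].$$ 2. The function $r\mapsto \mathrm{Cov}[\upsilon_d(B_r\cap V_o),\upsilon_d(V_o)]$ is $d$ times continuously differentiable on $[0,\infty)$ (one-sidedly at $0$), and its $d$-th derivative at $r=0$ vanishes. 3. Let $T(r)$ be the second-order Taylor (delta-method) expansion of $F_{R_o}(r)$,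 that is, the expectation of the second-order Taylor polynomial of $(z_1,z_2)\mapsto z_1/z_2$ around the point $(\mathbb{E}[\upsilon_d(B_r\cap V_o)],\mathbb{E}[\upsilon_d(V_o)])$, evaluated at $(\upsilon_d(B_r\cap V_o),\upsilon_d(V_o))$. Then $T$ is $d$ times continuously differentiable on $[0,\infty)$. In the approximation $$F_{R_o}(r)\approx 1-\exp(-\rho_d\lambda\kappa_d r^d)$$ the correction factor $\rho_d$ is determined by requiring that the $d$-th derivatives at $r=0$ of the right-hand side and of $T$ agree. Precisely: a real number $\rho$ satisfies $$\frac{\mathrm{d}^d}{\mathrm{d}r^d}\Big(1-\exp(-\rho\lambda\kappa_d r^d)\Big)\Big|_{r=0}=\frac{\mathrm{d}^d}{\mathrm{d}r^d}T(r)\Big|_{r=0}$$ (one-sided derivatives on $[0,\infty)$) if and only if $$\rho=\rho_d:=1+\frac{\mathrm{Var}[\upsilon_d(V_o)]}{\mathbb{E}[\upsilon_d(V_o)]^2}.$$ -/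

import Mathlib

open MeasureTheory ProbabilityTheory
open scoped NNReal ENNReal

namespace PoissonVoronoi

noncomputable section

/-- The number of points of the random set `Φ` in `A`. -/
def count {Ω : Type*} {d : ℕ} (Φ : Ω → Set (EuclideanSpace ℝ (Fin d)))
    (A : Set (EuclideanSpace ℝ (Fin d))) (ω : Ω) : ℕ∞ :=
  (Φ ω ∩ A).encard

/-- `Φ` is a homogeneous Poisson point process on `ℝ^d` with intensity `lam`: counts of Borel sets
are random variables, the count of a Borel set of finite volume is Poisson distributed with mean
`lam` times the volume, and the counts of finitely many pairwise disjoint such sets are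
independent. -/
structure IsPoissonProcess {Ω : Type*} [MeasurableSpace Ω] {d : ℕ}
    (Φ : Ω → Set (EuclideanSpace ℝ (Fin d))) (lam : ℝ≥0) (P : Measure Ω) : Prop where
  measurable_count : ∀ A, MeasurableSet A → Measurable (count Φ A)
  map_count : ∀ A, MeasurableSet A → volume A ≠ ∞ →
    P.map (count Φ A) =
      (poissonMeasure (lam * (volume A).toNNReal)).map (fun n : ℕ => (n : ℕ∞))
  indep_count : ∀ (n : ℕ) (A : Fin n → Set (EuclideanSpace ℝ (Fin d))),
    (∀ i, MeasurableSet (A i)) → (∀ i, volume (A i) ≠ ∞) →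
    Pairwise (fun i j => Disjoint (A i) (A j)) →
    iIndepFun (fun i => count Φ (A i)) P

/-- The σ-algebra on `Ω` generated by the point process `Φ`. -/
def sigmaOf {Ω : Type*} {d : ℕ} (Φ : Ω → Set (EuclideanSpace ℝ (Fin d))) : MeasurableSpace Ω :=
  ⨆ A : {A : Set (EuclideanSpace ℝ (Fin d)) // MeasurableSet A},
    MeasurableSpace.comap (count Φ A.1) inferInstance

/-- The Voronoi cell of the origin in the configuration `S ∪ {o}`. For a Poisson process `S` this
is the typical cell `V_o`. -/
def cell {d : ℕ} (S : Set (EuclideanSpace ℝ (Fin d))) : Set (EuclideanSpace ℝ (Fin d)) :=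
  {y | ∀ x ∈ S, ‖y‖ ≤ ‖x - y‖}

/-- `Y` is a uniformly random point of the typical cell: given the point process, `Y` has the
normalised Lebesgue measure on the cell as its conditional distribution. -/
structure IsUniformInCell {Ω : Type*} [MeasurableSpace Ω] {d : ℕ}
    (Y : Ω → EuclideanSpace ℝ (Fin d)) (Φ : Ω → Set (EuclideanSpace ℝ (Fin d)))
    (P : Measure Ω) : Prop where
  measurable : Measurable Y
  condProb : ∀ A, MeasurableSet A →
    P⟦Y ⁻¹' A | sigmaOf Φ⟧ =ᵐ[P] fun ω => (cond volume (cell (Φ ω))).real A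

/-- The random variable `vol V_o`. -/
def cellVol {Ω : Type*} {d : ℕ} (Φ : Ω → Set (EuclideanSpace ℝ (Fin d))) (ω : Ω) : ℝ :=
  volume.real (cell (Φ ω))

/-- The random variable `vol (B_r(o) ∩ V_o)`. -/
def ballCellVol {Ω : Type*} {d : ℕ} (Φ : Ω → Set (EuclideanSpace ℝ (Fin d))) (r : ℝ) (ω : Ω) : ℝ :=
  volume.real (Metric.closedBall 0 r ∩ cell (Φ ω))

/-- The volume `κ_d` of the unit ball of `ℝ^d`. -/
def kappa (d : ℕ) : ℝ := Real.pi ^ ((d : ℝ) / 2) / Real.Gamma ((d : ℝ) / 2 + 1)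

/-- The second-order Taylor polynomial of `f` around `p`, evaluated at `z`. -/
def taylorTwo (f : ℝ × ℝ → ℝ) (p z : ℝ × ℝ) : ℝ :=
  f p + fderiv ℝ f p (z - p) + (1 / 2) * fderiv ℝ (fderiv ℝ f) p (z - p) (z - p)

/-- The second-order (delta-method) expansion of `E[Z₁ / Z₂]`: the expectation of the second-order
Taylor polynomial of `(z₁, z₂) ↦ z₁ / z₂` around `(E[Z₁], E[Z₂])`, evaluated at `(Z₁, Z₂)`. -/
def deltaRatio {Ω : Type*} [MeasurableSpace Ω] (P : Measure Ω) (Z₁ Z₂ : Ω → ℝ) : ℝ :=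
  ∫ ω, taylorTwo (fun z => z.1 / z.2) (∫ ω', Z₁ ω' ∂P, ∫ ω', Z₂ ω' ∂P) (Z₁ ω, Z₂ ω) ∂P

end

end PoissonVoronoi

/-!
A point `y` lies in the cell of the origin iff the open ball around `y` through the origin is free
of points of the process. Hence both `y` and `z` lie in the cell with probability `exp (-lam * U)`,
where `U = unionVol y z` is the volume of the union of two such balls, and Fubini's theorem
expresses the mean of `vol (A ∩ V_o)` and its mixed moment with `vol V_o` as integrals of such
exponentials
(`IsPoissonProcess.integral_volume_inter_cell`, `IsPoissonProcess.integral_volume_inter_cell_mul`).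
In particular the mean of `vol V_o` is `1 / lam`, and the covariance of `vol (B_r ∩ V_o)` and
`vol V_o` is an integral over `B_r` of a function `H ‖y‖`, where
`H s = unionMoment lam 0 (s • e) - exp (-lam * κ * s ^ d) / lam` for any unit vector `e`.

The difficulty is the differentiability of order `d` up to `r = 0`: the volume of a union of two
balls is not smooth in its data. It is homogeneous, however: `U (r • e) (r • w) = r ^ d * U e w`.
After the substitution `z = r • w`, the function `r ↦ ∫ exp (-lam * U (r • e) z) dz` therefore is
`r ^ d` times a Laplace transform at `r ^ d`, and so is smooth for `r > 0`; moreover the Euler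
operator `θ = r * d/dr` maps the integrals `∫ U ^ k * exp (-lam * U) dz` to linear combinations of
integrals of the same kind, all of which are continuous at `r = 0` by dominated convergence
(`eulerRegular_unionMoment`). For a function `f` such that all `θ ^ j f` are continuous up to `0`,
the function `r ^ n * f r` has `n` continuous derivatives on `[0, ∞)`, the last of which is
`n! * f 0` at `0` (`EulerRegular.pow_mul`). In polar coordinates the derivative of an integral over
`B_r` of `f ‖y‖` is `d * κ * r ^ (d - 1) * f r`, so this integral has `d` derivatives, the last of
which is `d! * κ * f 0` at `0`. For the covariance this is `0` because `H 0 = 0`.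

Finally, the second-order expansion of the ratio is `M / m - Cov / m ^ 2 + M * Var / m ^ 3`
(`deltaRatio_eq`), where `M` and `m` are the means of `vol (B_r ∩ V_o)` and `vol V_o`. The `d`-th
derivative of `M` at `0` is `d! * κ`, the one of the covariance vanishes, and comparison with the
`d`-th derivative `d! * ρ * lam * κ` of `1 - exp (-ρ * lam * κ * r ^ d)` determines `ρ`.
-/

namespace PoissonVoronoi

open Set Filter Topology

/-! ### Euler derivatives and regularity at the endpoint -/

/-- `EulerRegular n f`: the functions `f, θ f, …, θⁿ f` are continuous on `[0, ∞)`, where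
`θ f = r ↦ r * f' r` is the Euler operator. The derivative is only required on `(0, ∞)`, and
`θ f` is only required to extend continuously to `0`, so that `f` itself need not be differentiable
at `0`. -/
def EulerRegular : ℕ → (ℝ → ℝ) → Prop
  | 0, f => ContinuousOn f (Ici 0)
  | n + 1, f => ContinuousOn f (Ici 0) ∧
      ∃ g : ℝ → ℝ, EulerRegular n g ∧ ∀ r, 0 < r → HasDerivAt f (g r / r) r

namespace EulerRegular

variable {n : ℕ} {f g : ℝ → ℝ}

theorem continuousOn (hf : EulerRegular n f) : ContinuousOn f (Ici 0) := by
  cases n with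
  | zero => exact hf
  | succ n => exact hf.1

theorem of_succ (hf : EulerRegular (n + 1) f) : EulerRegular n f := by
  induction n generalizing f with
  | zero => exact hf.1
  | succ n ih =>
    obtain ⟨hc, g, hg, hd⟩ := hf
    exact ⟨hc, g, ih hg, hd⟩

theorem add (hf : EulerRegular n f) (hg : EulerRegular n g) :
    EulerRegular n (fun r => f r + g r) := by
  induction n generalizing f g with
  | zero => exact ContinuousOn.add hf hg
  | succ n ih =>
    obtain ⟨hc, f', hf', hd⟩ := hf
    obtain ⟨hc₁, g', hg', hd₁⟩ := hg
    refine ⟨hc.add hc₁, _, ih hf' hg', fun r hr => ?_⟩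
    rw [add_div]
    exact (hd r hr).add (hd₁ r hr)

theorem const_mul (c : ℝ) (hf : EulerRegular n f) : EulerRegular n (fun r => c * f r) := by
  induction n generalizing f with
  | zero => exact ContinuousOn.mul continuousOn_const hf
  | succ n ih =>
    obtain ⟨hc, f', hf', hd⟩ := hf
    refine ⟨continuousOn_const.mul hc, _, ih hf', fun r hr => ?_⟩
    rw [mul_div_assoc]
    exact (hd r hr).const_mul c

theorem of_contDiff (hf : ContDiff ℝ n f) : EulerRegular n f := by
  induction n generalizing f with
  | zero => exact hf.continuous.continuousOn
  | succ n ih =>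
    have hf' := contDiff_succ_iff_deriv.1 (by exact_mod_cast hf : ContDiff ℝ ((n : ℕ∞) + 1) f)
    refine ⟨hf.continuous.continuousOn, fun r => r * deriv f r,
      ih (contDiff_id.mul (by exact_mod_cast hf'.2.2)), fun r hr => ?_⟩
    rw [mul_div_cancel_left₀ _ hr.ne']
    exact (hf'.1 r).hasDerivAt

end EulerRegular

/-- The derivative formula on `(0, ∞)` extends to `0` because its right-hand side is continuous
there, although `f` need not be differentiable at `0`. -/
theorem hasDerivWithinAt_pow_succ_mul {f g : ℝ → ℝ} (n : ℕ) (hf : ContinuousOn f (Ici 0))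
    (hg : ContinuousOn g (Ici 0)) (hd : ∀ r, 0 < r → HasDerivAt f (g r / r) r) {r : ℝ}
    (hr : 0 ≤ r) :
    HasDerivWithinAt (fun r => r ^ (n + 1) * f r) (r ^ n * ((n + 1) * f r + g r)) (Ici 0) r := by
  have hpos : ∀ s, 0 < s →
      HasDerivAt (fun r => r ^ (n + 1) * f r) (s ^ n * ((n + 1) * f s + g s)) s := by
    intro s hs
    refine ((hasDerivAt_pow (n + 1) s).fun_mul (hd s hs)).congr_deriv ?_
    rw [Nat.add_sub_cancel]
    push_cast
    field_simp
    ring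
  have hcont : ContinuousOn (fun s => s ^ n * ((n + 1) * f s + g s)) (Ici 0) := by fun_prop
  rcases hr.eq_or_lt with rfl | hr
  · refine hasDerivWithinAt_Ici_of_tendsto_deriv (s := Ioi 0)
      (fun s hs => (hpos s hs).differentiableAt.differentiableWithinAt) ?_ self_mem_nhdsWithin ?_
    · exact (ContinuousOn.mul (by fun_prop) hf 0 self_mem_Ici).mono Ioi_subset_Ici_self
    · refine Tendsto.congr' ?_ ((hcont 0 self_mem_Ici).mono Ioi_subset_Ici_self)
      filter_upwards [self_mem_nhdsWithin] with s hs using (hpos s hs).deriv.symm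
  · exact (hpos r hr).hasDerivWithinAt

/-- A continuous function cannot have a logarithmic singularity: if `r * f' r` has a limit at `0`,
then the limit is `0`. Both `f 0` and `f 0 + g 0` are the right derivative of `r * f r` at `0`. -/
theorem euler_derivative_zero {f g : ℝ → ℝ} (hf : ContinuousOn f (Ici 0))
    (hg : ContinuousOn g (Ici 0)) (hd : ∀ r, 0 < r → HasDerivAt f (g r / r) r) : g 0 = 0 := by
  have h1 := hasDerivWithinAt_pow_succ_mul 0 hf hg hd le_rfl
  have h2 : HasDerivWithinAt (fun r => r ^ (0 + 1) * f r) (f 0) (Ici 0) 0 := by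
    rw [hasDerivWithinAt_iff_tendsto_slope, Ici_sdiff_left]
    refine Tendsto.congr' ?_ ((hf 0 self_mem_Ici).mono Ioi_subset_Ici_self)
    filter_upwards [self_mem_nhdsWithin] with s hs
    have : s ≠ 0 := (mem_Ioi.1 hs).ne'
    simp [slope_def_field, this]
  have h3 := (uniqueDiffOn_Ici (0 : ℝ) 0 self_mem_Ici).eq_deriv _ h1 h2
  simpa using h3

/-- Multiplying by `rⁿ` turns `n` Euler derivatives into `n` ordinary derivatives up to `0`. -/
theorem EulerRegular.pow_mul {n : ℕ} {f : ℝ → ℝ} (hf : EulerRegular n f) :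
    ContDiffOn ℝ n (fun r => r ^ n * f r) (Ici 0) ∧
      iteratedDerivWithin n (fun r => r ^ n * f r) (Ici 0) 0 = n.factorial * f 0 := by
  induction n generalizing f with
  | zero =>
    have : ContinuousOn f (Ici 0) := hf
    simpa using this
  | succ n ih =>
    have hf₀ := hf.of_succ
    obtain ⟨hc, g, hg, hd⟩ := hf
    have hder : ∀ r ∈ Ici (0 : ℝ), derivWithin (fun r => r ^ (n + 1) * f r) (Ici 0) r =
        r ^ n * ((n + 1) * f r + g r) := fun r hr =>
      (hasDerivWithinAt_pow_succ_mul n hc hg.continuousOn hd hr).derivWithin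
        (uniqueDiffOn_Ici 0 r hr)
    obtain ⟨h1, h2⟩ := ih ((hf₀.const_mul (n + 1)).add hg)
    constructor
    · have := (contDiffOn_succ_iff_derivWithin (𝕜 := ℝ) (n := (n : WithTop ℕ∞))
        (f := fun r => r ^ (n + 1) * f r) (uniqueDiffOn_Ici (0 : ℝ))).2
        ⟨fun r hr => (hasDerivWithinAt_pow_succ_mul n hc hg.continuousOn hd
          hr).differentiableWithinAt, by simp, h1.congr hder⟩
      exact_mod_cast this
    · rw [iteratedDerivWithin_succ', iteratedDerivWithin_congr hder self_mem_Ici, h2,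
        euler_derivative_zero hc hg.continuousOn hd, Nat.factorial_succ]
      push_cast
      ring

theorem EulerRegular.primitive {n : ℕ} {f F : ℝ → ℝ} {c : ℝ} (hf : EulerRegular n f)
    (hF : ∀ r, 0 ≤ r → HasDerivWithinAt F (c * (r ^ n * f r)) (Ici 0) r) :
    ContDiffOn ℝ (n + 1 : ℕ) F (Ici 0) ∧
      iteratedDerivWithin (n + 1) F (Ici 0) 0 = c * (n.factorial * f 0) := by
  obtain ⟨h1, h2⟩ := hf.pow_mul
  have hder : ∀ r ∈ Ici (0 : ℝ), derivWithin F (Ici 0) r = c * (r ^ n * f r) := fun r hr =>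
    (hF r hr).derivWithin (uniqueDiffOn_Ici 0 r hr)
  constructor
  · have := (contDiffOn_succ_iff_derivWithin (𝕜 := ℝ) (n := (n : WithTop ℕ∞))
      (f := F) (uniqueDiffOn_Ici (0 : ℝ))).2
      ⟨fun r hr => (hF r hr).differentiableWithinAt, by simp,
        (contDiffOn_const.mul h1).congr hder⟩
    exact_mod_cast this
  · rw [iteratedDerivWithin_succ', iteratedDerivWithin_congr hder self_mem_Ici,
      iteratedDerivWithin_const_mul self_mem_Ici (uniqueDiffOn_Ici 0) c (h1 0 self_mem_Ici), h2]

section Ball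

variable {d : ℕ}

theorem setIntegral_closedBall_norm (hd : 1 ≤ d) (h : ℝ → ℝ) {r : ℝ} (hr : 0 ≤ r) :
    ∫ y in Metric.closedBall (0 : EuclideanSpace ℝ (Fin d)) r, h ‖y‖ =
      d * volume.real (Metric.ball (0 : EuclideanSpace ℝ (Fin d)) 1) *
        ∫ s in (0 : ℝ)..r, s ^ (d - 1) * h s := by
  have : Nonempty (Fin d) := ⟨⟨0, hd⟩⟩
  have h1 : ∀ y : EuclideanSpace ℝ (Fin d), (Metric.closedBall 0 r).indicator (fun y => h ‖y‖) y =
      (Iic r).indicator h ‖y‖ := by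
    intro y
    by_cases hy : ‖y‖ ≤ r <;> simp [indicator, hy]
  rw [← integral_indicator measurableSet_closedBall, integral_congr_ae (ae_of_all _ h1),
    integral_fun_norm_addHaar volume ((Iic r).indicator h)]
  have h2 : ∀ y : ℝ, y ^ (d - 1) • (Iic r).indicator h y =
      (Iic r).indicator (fun s => s ^ (d - 1) * h s) y := by
    intro y
    by_cases hy : y ≤ r <;> simp [indicator, hy]
  rw [finrank_euclideanSpace_fin]
  simp_rw [h2]
  rw [setIntegral_indicator measurableSet_Iic, Ioi_inter_Iic,
    ← intervalIntegral.integral_of_le hr]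
  simp [mul_assoc]

/-- In polar coordinates the integral is a primitive of `d * κ * r ^ (d - 1) * h r`. -/
theorem EulerRegular.setIntegral_closedBall (hd : 1 ≤ d) {h : ℝ → ℝ} (hh : EulerRegular (d - 1) h) :
    ContDiffOn ℝ d (fun r => ∫ y in Metric.closedBall (0 : EuclideanSpace ℝ (Fin d)) r, h ‖y‖)
        (Ici 0) ∧
      iteratedDerivWithin d
        (fun r => ∫ y in Metric.closedBall (0 : EuclideanSpace ℝ (Fin d)) r, h ‖y‖) (Ici 0) 0 =
        d.factorial * volume.real (Metric.ball (0 : EuclideanSpace ℝ (Fin d)) 1) * h 0 := by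
  set κ := volume.real (Metric.ball (0 : EuclideanSpace ℝ (Fin d)) 1)
  -- `h` is only continuous on `[0, ∞)`, so it is extended by the constant `h 0` to the left
  set q : ℝ → ℝ := fun s => (max s 0) ^ (d - 1) * h (max s 0) with hq
  have hqc : Continuous q := by
    have : Continuous fun s : ℝ => h (max s 0) :=
      hh.continuousOn.comp_continuous (by fun_prop) fun s => mem_Ici.2 (le_max_right _ _)
    exact Continuous.mul (by fun_prop) this
  have hF : ∀ r ∈ Ici (0 : ℝ), ∫ y in Metric.closedBall (0 : EuclideanSpace ℝ (Fin d)) r, h ‖y‖ =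
      d * κ * ∫ s in (0 : ℝ)..r, q s := by
    intro r hr
    rw [setIntegral_closedBall_norm hd h hr]
    congr 1
    refine intervalIntegral.integral_congr fun s hs => ?_
    rw [uIcc_of_le hr] at hs
    simp [hq, max_eq_left hs.1]
  have key := hh.primitive (c := d * κ)
    (F := fun r => ∫ y in Metric.closedBall (0 : EuclideanSpace ℝ (Fin d)) r, h ‖y‖) (by
      intro r hr
      refine HasDerivWithinAt.congr ?_ hF (hF r hr)
      have := ((hqc.integral_hasStrictDerivAt 0 r).hasDerivAt.const_mul
        (d * κ)).hasDerivWithinAt (s := Ici 0)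
      simpa [hq, max_eq_left hr] using this)
  rw [Nat.sub_add_cancel hd] at key
  refine ⟨key.1, key.2.trans ?_⟩
  rw [← Nat.mul_factorial_pred (by omega : d ≠ 0)]
  push_cast
  ring

end Ball

/-! ### Volumes of unions of two balls -/

section UnionVol

variable {d : ℕ}

theorem volume_real_ball (hd : 1 ≤ d) (y : EuclideanSpace ℝ (Fin d)) {r : ℝ} (hr : 0 ≤ r) :
    volume.real (Metric.ball y r) = kappa d * r ^ d := by
  have : Nonempty (Fin d) := ⟨⟨0, hd⟩⟩
  have hΓ : 0 < Real.Gamma ((d : ℝ) / 2 + 1) := Real.Gamma_pos_of_pos (by positivity)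
  rw [measureReal_def, EuclideanSpace.volume_ball, ENNReal.toReal_mul, ENNReal.toReal_pow,
    ENNReal.toReal_ofReal hr, ENNReal.toReal_ofReal (by simpa using by positivity), kappa,
    Fintype.card_fin, mul_comm, Real.sqrt_eq_rpow, ← Real.rpow_natCast (Real.pi ^ (1 / 2 : ℝ)),
    ← Real.rpow_mul Real.pi_pos.le]
  congr 3
  ring

theorem kappa_pos (d : ℕ) : 0 < kappa d := by
  have hΓ : 0 < Real.Gamma ((d : ℝ) / 2 + 1) := Real.Gamma_pos_of_pos (by positivity)
  have := Real.pi_pos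
  unfold kappa
  positivity

theorem integrable_exp_neg_norm_pow (hd : 1 ≤ d) {c : ℝ} (hc : 0 < c) :
    Integrable fun w : EuclideanSpace ℝ (Fin d) => Real.exp (-(c * ‖w‖ ^ d)) := by
  have : Nonempty (Fin d) := ⟨⟨0, hd⟩⟩
  rw [integrable_fun_norm_addHaar volume (f := fun s => Real.exp (-(c * s ^ d))),
    finrank_euclideanSpace_fin]
  have h := integrableOn_rpow_mul_exp_neg_mul_rpow (p := d) (s := (d - 1 : ℕ))
    (neg_one_lt_zero.trans_le (Nat.cast_nonneg _)) (by exact_mod_cast hd) hc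
  simpa using h

theorem integral_exp_neg_norm_pow (hd : 1 ≤ d) {lam : ℝ} (hlam : 0 < lam) :
    ∫ w : EuclideanSpace ℝ (Fin d), Real.exp (-(lam * (kappa d * ‖w‖ ^ d))) = lam⁻¹ := by
  have : Nonempty (Fin d) := ⟨⟨0, hd⟩⟩
  have hκ := kappa_pos d
  have hd' : (0 : ℝ) < d := by exact_mod_cast hd
  rw [integral_fun_norm_addHaar volume (fun s => Real.exp (-(lam * (kappa d * s ^ d)))),
    finrank_euclideanSpace_fin, volume_real_ball hd _ zero_le_one]
  have h := integral_rpow_mul_exp_neg_mul_rpow (p := d) (q := (d - 1 : ℕ)) (b := lam * kappa d)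
    (by exact_mod_cast hd) (neg_one_lt_zero.trans_le (Nat.cast_nonneg _)) (by positivity)
  have hd₁ : ((d - 1 : ℕ) : ℝ) + 1 = d := by exact_mod_cast Nat.sub_add_cancel hd
  simp only [Real.rpow_natCast, hd₁, div_self hd'.ne', Real.Gamma_one, neg_div, Real.rpow_neg_one,
    neg_mul, mul_assoc] at h
  simp only [smul_eq_mul, h, nsmul_eq_mul, one_pow, mul_one]
  field_simp

/-- The volume of the set that has to be free of points for both `y` and `z` to lie in the cell of
the origin. -/
noncomputable def unionVol (y z : EuclideanSpace ℝ (Fin d)) : ℝ :=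
  volume.real (Metric.ball y ‖y‖ ∪ Metric.ball z ‖z‖)

theorem volume_ball_union_ne_top (y z : EuclideanSpace ℝ (Fin d)) :
    volume (Metric.ball y ‖y‖ ∪ Metric.ball z ‖z‖) ≠ ∞ :=
  (measure_union_lt_top measure_ball_lt_top measure_ball_lt_top).ne

theorem unionVol_nonneg (y z : EuclideanSpace ℝ (Fin d)) : 0 ≤ unionVol y z := measureReal_nonneg

theorem unionVol_comm (y z : EuclideanSpace ℝ (Fin d)) : unionVol y z = unionVol z y := by
  rw [unionVol, union_comm, ← unionVol]

theorem le_unionVol (hd : 1 ≤ d) (y z : EuclideanSpace ℝ (Fin d)) :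
    kappa d * ‖z‖ ^ d ≤ unionVol y z := by
  rw [← volume_real_ball hd z (norm_nonneg z)]
  exact measureReal_mono subset_union_right (volume_ball_union_ne_top y z)

theorem unionVol_le (hd : 1 ≤ d) (y z : EuclideanSpace ℝ (Fin d)) :
    unionVol y z ≤ kappa d * ‖y‖ ^ d + kappa d * ‖z‖ ^ d := by
  rw [← volume_real_ball hd z (norm_nonneg z), ← volume_real_ball hd y (norm_nonneg y)]
  exact measureReal_union_le _ _

theorem unionVol_zero_left (hd : 1 ≤ d) (z : EuclideanSpace ℝ (Fin d)) :
    unionVol 0 z = kappa d * ‖z‖ ^ d := by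
  rw [← volume_real_ball hd z (norm_nonneg z)]
  simp [unionVol]

open scoped Pointwise in
theorem unionVol_smul {r : ℝ} (hr : 0 < r) (y z : EuclideanSpace ℝ (Fin d)) :
    unionVol (r • y) (r • z) = r ^ d * unionVol y z := by
  have h : ∀ x : EuclideanSpace ℝ (Fin d),
      Metric.ball (r • x) ‖r • x‖ = r • Metric.ball x ‖x‖ := by
    intro x
    rw [smul_ball hr.ne', norm_smul]
  rw [unionVol, h, h, ← Set.smul_set_union, measureReal_def, Measure.addHaar_smul,
    ENNReal.toReal_mul, finrank_euclideanSpace_fin, ENNReal.toReal_ofReal (abs_nonneg _),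
    abs_of_pos (by positivity)]
  rfl

theorem unionVol_map (R : EuclideanSpace ℝ (Fin d) ≃ₗᵢ[ℝ] EuclideanSpace ℝ (Fin d))
    (y z : EuclideanSpace ℝ (Fin d)) : unionVol (R y) (R z) = unionVol y z := by
  rw [unionVol, unionVol, measureReal_def, measureReal_def, ← R.measurePreserving.measure_preimage
    (measurableSet_ball.union measurableSet_ball).nullMeasurableSet, preimage_union,
    R.preimage_ball, R.preimage_ball]
  simp

theorem measurable_unionVol :
    Measurable fun p : EuclideanSpace ℝ (Fin d) × EuclideanSpace ℝ (Fin d) =>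
      unionVol p.1 p.2 := by
  have hS : MeasurableSet {q : (EuclideanSpace ℝ (Fin d) × EuclideanSpace ℝ (Fin d)) ×
      EuclideanSpace ℝ (Fin d) | dist q.2 q.1.1 < ‖q.1.1‖ ∨ dist q.2 q.1.2 < ‖q.1.2‖} :=
    (measurableSet_lt (measurable_snd.dist measurable_fst.fst) measurable_fst.fst.norm).union
      (measurableSet_lt (measurable_snd.dist measurable_fst.snd) measurable_fst.snd.norm)
  exact (measurable_measure_prodMk_left (ν := volume) hS).ennreal_toReal

theorem measurable_unionVol_right (y : EuclideanSpace ℝ (Fin d)) : Measurable (unionVol y) :=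
  measurable_unionVol.of_uncurry_left (f := unionVol)

theorem pow_mul_exp_neg_le {x c : ℝ} (hx : 0 ≤ x) (hc : 0 < c) (k : ℕ) :
    x ^ k * Real.exp (-(c * x)) ≤ k.factorial / (c / 2) ^ k * Real.exp (-(c / 2 * x)) := by
  have h := Real.pow_div_factorial_le_exp (x := c / 2 * x) (by positivity) k
  rw [div_le_iff₀ (by positivity), mul_pow] at h
  have h2 : Real.exp (-(c * x)) = Real.exp (-(c / 2 * x)) * Real.exp (-(c / 2 * x)) := by
    rw [← Real.exp_add]
    ring_nf
  have h3 : Real.exp (c / 2 * x) * Real.exp (-(c / 2 * x)) = 1 := by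
    rw [← Real.exp_add]
    simp
  have hck : 0 < (c / 2) ^ k := by positivity
  rw [h2, div_mul_eq_mul_div (k.factorial : ℝ), le_div_iff₀ hck]
  have hE := (Real.exp_pos (-(c / 2 * x))).le
  calc x ^ k * (Real.exp (-(c / 2 * x)) * Real.exp (-(c / 2 * x))) * (c / 2) ^ k
      = ((c / 2) ^ k * x ^ k) * (Real.exp (-(c / 2 * x)) * Real.exp (-(c / 2 * x))) := by ring
    _ ≤ (Real.exp (c / 2 * x) * k.factorial) *
        (Real.exp (-(c / 2 * x)) * Real.exp (-(c / 2 * x))) := by gcongr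
    _ = k.factorial * Real.exp (-(c / 2 * x)) *
        (Real.exp (c / 2 * x) * Real.exp (-(c / 2 * x))) := by ring
    _ = _ := by rw [h3, mul_one]

/-- An integrable bound that does not depend on `y`. It uses only that the union contains the ball
around `z`, and half of the exponential to absorb the power. -/
theorem unionVol_pow_mul_exp_le (hd : 1 ≤ d) {c : ℝ} (hc : 0 < c) (k : ℕ)
    (y z : EuclideanSpace ℝ (Fin d)) :
    unionVol y z ^ k * Real.exp (-(c * unionVol y z)) ≤
      k.factorial / (c / 2) ^ k * Real.exp (-(c / 2 * kappa d * ‖z‖ ^ d)) := by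
  refine (pow_mul_exp_neg_le (unionVol_nonneg y z) hc k).trans ?_
  have := le_unionVol hd y z
  rw [mul_assoc (c / 2)]
  gcongr

theorem integrable_unionVol_bound (hd : 1 ≤ d) {c : ℝ} (hc : 0 < c) (k : ℕ) :
    Integrable fun z : EuclideanSpace ℝ (Fin d) =>
      k.factorial / (c / 2) ^ k * Real.exp (-(c / 2 * kappa d * ‖z‖ ^ d)) :=
  (integrable_exp_neg_norm_pow hd (mul_pos (half_pos hc) (kappa_pos d))).const_mul _

theorem aestronglyMeasurable_unionVol_pow_mul_exp (y : EuclideanSpace ℝ (Fin d)) (c : ℝ) (k : ℕ) :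
    AEStronglyMeasurable fun z => unionVol y z ^ k * Real.exp (-(c * unionVol y z)) := by
  have := measurable_unionVol_right y
  exact Measurable.aestronglyMeasurable (by fun_prop)

theorem integrable_unionVol_pow_mul_exp (hd : 1 ≤ d) (y : EuclideanSpace ℝ (Fin d)) {c : ℝ}
    (hc : 0 < c) (k : ℕ) :
    Integrable fun z => unionVol y z ^ k * Real.exp (-(c * unionVol y z)) := by
  refine (integrable_unionVol_bound hd hc k).mono'
    (aestronglyMeasurable_unionVol_pow_mul_exp y c k) (ae_of_all _ fun z => ?_)
  have := unionVol_nonneg y z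
  rw [Real.norm_of_nonneg (by positivity)]
  exact unionVol_pow_mul_exp_le hd hc k y z

/-- `∫ Uᵏ exp (-c U) dz` with `U = unionVol y z`. For `k = 0` and `c` the intensity of the Poisson
process this is the expected volume of the cell on the event that `y` lies in it. -/
noncomputable def unionMoment (c : ℝ) (k : ℕ) (y : EuclideanSpace ℝ (Fin d)) : ℝ :=
  ∫ z, unionVol y z ^ k * Real.exp (-(c * unionVol y z))

/-- Rotation invariance, by the reflection that interchanges `y` and `y'`. -/
theorem unionMoment_eq_of_norm_eq (c : ℝ) (k : ℕ) {y y' : EuclideanSpace ℝ (Fin d)}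
    (h : ‖y‖ = ‖y'‖) : unionMoment c k y = unionMoment c k y' := by
  set R := (ℝ ∙ (y - y'))ᗮ.reflection
  have hR : R y = y' := Submodule.reflection_sub h
  refine Eq.trans (integral_congr_ae (ae_of_all _ fun z => ?_))
    (R.measurePreserving.integral_comp' (f := R.toMeasurableEquiv) _)
  have : unionVol y' (R z) = unionVol y z := by rw [← hR, unionVol_map]
  simp [this]

theorem hasDerivAt_unionMoment (hd : 1 ≤ d) {c : ℝ} (hc : 0 < c) (k : ℕ)
    (y : EuclideanSpace ℝ (Fin d)) :
    HasDerivAt (fun c => unionMoment c k y) (-unionMoment c (k + 1) y) c := by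
  have key := hasDerivAt_integral_of_dominated_loc_of_deriv_le (μ := volume) (x₀ := c)
    (F := fun c z => unionVol y z ^ k * Real.exp (-(c * unionVol y z)))
    (F' := fun c z => -(unionVol y z ^ (k + 1) * Real.exp (-(c * unionVol y z))))
    (bound := fun z => (k + 1).factorial / (c / 2 / 2) ^ (k + 1) *
      Real.exp (-(c / 2 / 2 * kappa d * ‖z‖ ^ d)))
    (s := Ioi (c / 2)) (Ioi_mem_nhds (by linarith))
    (Eventually.of_forall fun x => aestronglyMeasurable_unionVol_pow_mul_exp y x k)
    (integrable_unionVol_pow_mul_exp hd y hc k)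
    (aestronglyMeasurable_unionVol_pow_mul_exp y c (k + 1)).neg
    (ae_of_all _ fun z x hx => ?_) (integrable_unionVol_bound hd (half_pos hc) (k + 1))
    (ae_of_all _ fun z x _ => ?_)
  · have h := key.2
    rw [integral_neg] at h
    exact h
  · have hU := unionVol_nonneg y z
    rw [norm_neg, Real.norm_of_nonneg (by positivity)]
    refine le_trans ?_ (unionVol_pow_mul_exp_le hd (half_pos hc) (k + 1) y z)
    have := (mem_Ioi.1 hx).le
    gcongr
  · refine ((((hasDerivAt_id x).mul_const (unionVol y z)).fun_neg.exp).const_mul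
      (unionVol y z ^ k)).congr_deriv ?_
    simp only [id]
    ring

/-- The substitution `z = r • w` moves the dependence on `r` from the union of balls, whose volume
is not smooth in `r`, to the parameter of a Laplace transform. -/
theorem unionMoment_smul {r : ℝ} (hr : 0 < r) (c : ℝ) (k : ℕ) (y : EuclideanSpace ℝ (Fin d)) :
    unionMoment c k (r • y) = (r ^ d) ^ (k + 1) * unionMoment (c * r ^ d) k y := by
  have h := Measure.integral_comp_smul volume
    (fun z => unionVol (r • y) z ^ k * Real.exp (-(c * unionVol (r • y) z))) r
  have hrd : 0 < r ^ d := by positivity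
  rw [finrank_euclideanSpace_fin, abs_of_pos (by positivity), smul_eq_mul,
    eq_inv_mul_iff_mul_eq₀ hrd.ne'] at h
  rw [unionMoment, ← h, unionMoment, ← integral_const_mul, ← integral_const_mul]
  refine integral_congr_ae (ae_of_all _ fun z => ?_)
  simp only [unionVol_smul hr, ← mul_assoc c]
  ring

theorem hasDerivAt_unionMoment_smul (hd : 1 ≤ d) {c : ℝ} (hc : 0 < c) (k : ℕ)
    (y : EuclideanSpace ℝ (Fin d)) {r : ℝ} (hr : 0 < r) :
    HasDerivAt (fun r : ℝ => unionMoment c k (r • y))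
      ((d * (k + 1) * unionMoment c k (r • y) + -(d * c) * unionMoment c (k + 1) (r • y)) / r)
      r := by
  have h1 : HasDerivAt (fun r : ℝ => (r ^ d) ^ (k + 1) * unionMoment (c * r ^ d) k y) _ r :=
    ((hasDerivAt_pow d r).fun_pow (k + 1)).fun_mul
      (HasDerivAt.comp r (h₂ := fun c => unionMoment c k y) (h := fun r => c * r ^ d)
        (hasDerivAt_unionMoment hd (by positivity : 0 < c * r ^ d) k y)
        ((hasDerivAt_pow d r).const_mul c))
  refine (h1.congr_of_eventuallyEq ?_).congr_deriv ?_
  · filter_upwards [Ioi_mem_nhds hr] with s hs using unionMoment_smul hs c k y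
  · obtain ⟨m, rfl⟩ : ∃ m, d = m + 1 := ⟨d - 1, by omega⟩
    rw [unionMoment_smul hr, unionMoment_smul hr, eq_div_iff hr.ne']
    simp only [Nat.add_sub_cancel]
    push_cast
    ring

theorem continuousOn_unionMoment_smul (hd : 1 ≤ d) {c : ℝ} (hc : 0 < c) (k : ℕ)
    (y : EuclideanSpace ℝ (Fin d)) :
    ContinuousOn (fun r : ℝ => unionMoment c k (r • y)) (Ici 0) := by
  intro r hr
  rcases (mem_Ici.1 hr).eq_or_lt with rfl | hr
  -- at the origin, `kappa d * ‖z‖ ^ d ≤ U ≤ kappa d * r ^ d + kappa d * ‖z‖ ^ d` gives convergence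
  · refine tendsto_integral_filter_of_dominated_convergence _
      (Eventually.of_forall fun s => aestronglyMeasurable_unionVol_pow_mul_exp _ _ _)
      (Eventually.of_forall fun s => ae_of_all _ fun z => ?_)
      (integrable_unionVol_bound hd hc k) (ae_of_all _ fun z => ?_)
    · have := unionVol_nonneg (s • y) z
      rw [Real.norm_of_nonneg (by positivity)]
      exact unionVol_pow_mul_exp_le hd hc k _ z
    · have h : Tendsto (fun s : ℝ => unionVol (s • y) z) (𝓝[Ici 0] 0)
          (𝓝 (unionVol ((0 : ℝ) • y) z)) := by
        rw [zero_smul, unionVol_zero_left hd]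
        refine tendsto_of_tendsto_of_tendsto_of_le_of_le tendsto_const_nhds ?_
          (fun s => le_unionVol hd _ z) (fun s => unionVol_le hd _ z)
        have : Continuous fun s : ℝ => kappa d * ‖s • y‖ ^ d + kappa d * ‖z‖ ^ d := by fun_prop
        refine tendsto_nhdsWithin_of_tendsto_nhds ?_
        convert this.tendsto 0
        simp [show d ≠ 0 by omega]
      exact (h.pow k).mul ((h.const_mul c).neg.rexp)
  · exact (hasDerivAt_unionMoment_smul hd hc k y hr).continuousAt.continuousWithinAt

/-- The Euler operator maps `unionMoment c k` into the span of the moments of orders `k` and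
`k + 1`, and each of these is continuous up to the origin. -/
theorem eulerRegular_unionMoment (hd : 1 ≤ d) {c : ℝ} (hc : 0 < c) (n k : ℕ)
    (y : EuclideanSpace ℝ (Fin d)) : EulerRegular n fun r : ℝ => unionMoment c k (r • y) := by
  induction n generalizing k with
  | zero => exact continuousOn_unionMoment_smul hd hc k y
  | succ n ih =>
    exact ⟨continuousOn_unionMoment_smul hd hc k y, _,
      ((ih k).const_mul (d * (k + 1))).add ((ih (k + 1)).const_mul (-(d * c))),
      fun r hr => hasDerivAt_unionMoment_smul hd hc k y hr⟩

theorem unionMoment_zero_zero (hd : 1 ≤ d) {c : ℝ} (hc : 0 < c) :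
    unionMoment c 0 (0 : EuclideanSpace ℝ (Fin d)) = c⁻¹ := by
  simp_rw [unionMoment, unionVol_zero_left hd, pow_zero, one_mul]
  exact integral_exp_neg_norm_pow hd hc

end UnionVol

/-! ### The cell of a Poisson process -/

section Cell

variable {Ω : Type*} {d : ℕ}

theorem isClosed_cell (S : Set (EuclideanSpace ℝ (Fin d))) : IsClosed (cell S) := by
  have : cell S = ⋂ x ∈ S, {y | ‖y‖ ≤ ‖x - y‖} := by
    ext y
    simp [cell]
  rw [this]
  exact isClosed_biInter fun x _ => isClosed_le (by fun_prop) (by fun_prop)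

theorem count_eq_zero_iff {Φ : Ω → Set (EuclideanSpace ℝ (Fin d))}
    {A : Set (EuclideanSpace ℝ (Fin d))} {ω : Ω} : count Φ A ω = 0 ↔ Φ ω ∩ A = ∅ := by
  rw [count, encard_eq_zero]

theorem mem_cell_and_mem_cell_iff {Φ : Ω → Set (EuclideanSpace ℝ (Fin d))}
    {y z : EuclideanSpace ℝ (Fin d)} {ω : Ω} :
    y ∈ cell (Φ ω) ∧ z ∈ cell (Φ ω) ↔
      count Φ (Metric.ball y ‖y‖ ∪ Metric.ball z ‖z‖) ω = 0 := by
  simp only [count_eq_zero_iff, cell, mem_ofPred_eq, eq_empty_iff_forall_notMem, mem_inter_iff,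
    mem_union, mem_ball_iff_norm, not_and, not_or, not_lt]
  exact ⟨fun h x hx => ⟨h.1 x hx, h.2 x hx⟩, fun h => ⟨fun x hx => (h x hx).1,
    fun x hx => (h x hx).2⟩⟩

theorem mem_cell_iff {Φ : Ω → Set (EuclideanSpace ℝ (Fin d))}
    {y : EuclideanSpace ℝ (Fin d)} {ω : Ω} :
    y ∈ cell (Φ ω) ↔ count Φ (Metric.ball y ‖y‖) ω = 0 := by
  rw [← and_self_iff (a := y ∈ cell (Φ ω)), mem_cell_and_mem_cell_iff, union_self]

variable [MeasurableSpace Ω] {Φ : Ω → Set (EuclideanSpace ℝ (Fin d))}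

/-- If a point of `Φ` lies in the open ball around `y` through the origin, then so does a ball with
rational data that contains this point. Hence the complement of the set of pairs `(ω, y)` with `y`
in the cell is a countable union of measurable rectangles. -/
theorem measurableSet_mem_cell (hΦ : ∀ A, MeasurableSet A → Measurable (count Φ A)) :
    MeasurableSet {p : Ω × EuclideanSpace ℝ (Fin d) | p.2 ∈ cell (Φ p.1)} := by
  set u := TopologicalSpace.denseSeq (EuclideanSpace ℝ (Fin d))
  have hcompl : {p : Ω × EuclideanSpace ℝ (Fin d) | p.2 ∈ cell (Φ p.1)}ᶜ =
      ⋃ (n : ℕ) (δ : ℚ), (count Φ (Metric.ball (u n) δ) ⁻¹' {0}ᶜ) ×ˢ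
        {y | dist (u n) y + δ ≤ ‖y‖} := by
    ext ⟨ω, y⟩
    simp only [mem_compl_iff, mem_ofPred_eq, mem_cell_iff, count_eq_zero_iff, mem_iUnion, mem_prod,
      mem_preimage, mem_singleton_iff, ← ne_eq, ← nonempty_iff_ne_empty]
    constructor
    · rintro ⟨x, hx, hxy⟩
      rw [Metric.mem_ball] at hxy
      obtain ⟨δ, hδ, hδ'⟩ := exists_rat_btwn (half_pos (sub_pos.2 hxy))
      obtain ⟨n, hn⟩ := (TopologicalSpace.denseRange_denseSeq
        (EuclideanSpace ℝ (Fin d))).exists_dist_lt x hδ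
      refine ⟨n, δ, ⟨x, hx, hn⟩, ?_⟩
      have := dist_triangle (u n) x y
      rw [dist_comm (u n) x] at this
      linarith
    · rintro ⟨n, δ, ⟨x, hx, hxδ⟩, hy⟩
      refine ⟨x, hx, Metric.mem_ball.2 ?_⟩
      have := dist_triangle x (u n) y
      have := Metric.mem_ball.1 hxδ
      linarith
  rw [← MeasurableSet.compl_iff, hcompl]
  exact MeasurableSet.iUnion fun n => MeasurableSet.iUnion fun δ =>
    (hΦ _ measurableSet_ball (measurableSet_singleton 0).compl).prod
      (measurableSet_le (by fun_prop) (by fun_prop))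

theorem measurable_volume_inter_cell (hΦ : ∀ A, MeasurableSet A → Measurable (count Φ A))
    {A : Set (EuclideanSpace ℝ (Fin d))} (hA : MeasurableSet A) :
    Measurable fun ω => volume (A ∩ cell (Φ ω)) :=
  measurable_measure_prodMk_left (ν := volume)
    ((measurable_snd hA).inter (measurableSet_mem_cell hΦ))

end Cell

section Poisson

variable {Ω : Type*} [MeasurableSpace Ω] {P : Measure Ω} {d : ℕ}
  {lam : ℝ≥0} {Φ : Ω → Set (EuclideanSpace ℝ (Fin d))}

namespace IsPoissonProcess

theorem measure_count_eq_zero (hΦ : IsPoissonProcess Φ lam P) {A : Set (EuclideanSpace ℝ (Fin d))}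
    (hA : MeasurableSet A) (hA' : volume A ≠ ∞) :
    P {ω | count Φ A ω = 0} = ENNReal.ofReal (Real.exp (-(lam * volume.real A))) := by
  have h := congrArg (fun μ => μ {(0 : ℕ∞)}) (hΦ.map_count A hA hA')
  simp only [Measure.map_apply (hΦ.measurable_count A hA) (measurableSet_singleton _),
    Measure.map_apply (measurable_of_countable _) (measurableSet_singleton _)] at h
  have h0 : (fun n : ℕ => (n : ℕ∞)) ⁻¹' {0} = {0} := by
    ext n
    simp
  rw [h0, poissonMeasure_singleton] at h
  have hr : (volume A).toNNReal = volume.real A := rfl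
  have hs : {ω | count Φ A ω = 0} = count Φ A ⁻¹' {0} := rfl
  simpa [hr, hs] using h

theorem measure_mem_cell_and_mem_cell (hΦ : IsPoissonProcess Φ lam P)
    (y z : EuclideanSpace ℝ (Fin d)) :
    P {ω | y ∈ cell (Φ ω) ∧ z ∈ cell (Φ ω)} =
      ENNReal.ofReal (Real.exp (-(lam * unionVol y z))) := by
  simp_rw [mem_cell_and_mem_cell_iff]
  exact hΦ.measure_count_eq_zero (measurableSet_ball.union measurableSet_ball)
    (volume_ball_union_ne_top y z)

theorem measure_mem_cell (hd : 1 ≤ d) (hΦ : IsPoissonProcess Φ lam P)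
    (y : EuclideanSpace ℝ (Fin d)) :
    P {ω | y ∈ cell (Φ ω)} = ENNReal.ofReal (Real.exp (-(lam * (kappa d * ‖y‖ ^ d)))) := by
  simp_rw [mem_cell_iff]
  rw [hΦ.measure_count_eq_zero measurableSet_ball measure_ball_lt_top.ne,
    volume_real_ball hd y (norm_nonneg y)]

variable [IsProbabilityMeasure P]

theorem lintegral_volume_inter_cell (hd : 1 ≤ d) (hΦ : IsPoissonProcess Φ lam P)
    {A : Set (EuclideanSpace ℝ (Fin d))} (hA : MeasurableSet A) :
    ∫⁻ ω, volume (A ∩ cell (Φ ω)) ∂P =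
      ∫⁻ y in A, ENNReal.ofReal (Real.exp (-(lam * (kappa d * ‖y‖ ^ d)))) := by
  have hS : MeasurableSet {p : Ω × EuclideanSpace ℝ (Fin d) | p.2 ∈ A ∧ p.2 ∈ cell (Φ p.1)} :=
    (measurable_snd hA).inter (measurableSet_mem_cell hΦ.measurable_count)
  have h := (Measure.prod_apply (μ := P) (ν := volume) hS).symm.trans
    (Measure.prod_apply_symm hS)
  refine h.trans ?_
  rw [← lintegral_indicator hA]
  refine lintegral_congr fun y => ?_
  by_cases hy : y ∈ A
  · simpa [hy] using hΦ.measure_mem_cell hd y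
  · simp [hy]

theorem lintegral_volume_inter_cell_mul (hΦ : IsPoissonProcess Φ lam P)
    {A B : Set (EuclideanSpace ℝ (Fin d))} (hA : MeasurableSet A) (hB : MeasurableSet B) :
    ∫⁻ ω, volume (A ∩ cell (Φ ω)) * volume (B ∩ cell (Φ ω)) ∂P =
      ∫⁻ y in A, ∫⁻ z in B, ENNReal.ofReal (Real.exp (-(lam * unionVol y z))) := by
  set S := {p : Ω × (EuclideanSpace ℝ (Fin d) × EuclideanSpace ℝ (Fin d)) |
    (p.2.1 ∈ A ∧ p.2.1 ∈ cell (Φ p.1)) ∧ (p.2.2 ∈ B ∧ p.2.2 ∈ cell (Φ p.1))} with hS_def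
  have hcell := measurableSet_mem_cell hΦ.measurable_count
  have hS : MeasurableSet S :=
    ((measurable_snd.fst hA).inter ((measurable_fst.prodMk measurable_snd.fst) hcell)).inter
      ((measurable_snd.snd hB).inter ((measurable_fst.prodMk measurable_snd.snd) hcell))
  have h := (Measure.prod_apply (μ := P) (ν := (volume : Measure (EuclideanSpace ℝ (Fin d))).prod
    volume) hS).symm.trans (Measure.prod_apply_symm hS)
  have h1 : ∀ ω, Prod.mk ω ⁻¹' S = (A ∩ cell (Φ ω)) ×ˢ (B ∩ cell (Φ ω)) := fun ω => rfl
  simp_rw [h1, Measure.prod_prod] at h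
  have hmeas := measurable_unionVol (d := d)
  rw [h, ← lintegral_prod (μ := volume.restrict A) (ν := volume.restrict B)
    (fun p => ENNReal.ofReal (Real.exp (-(lam * unionVol p.1 p.2))))
    (Measurable.aemeasurable (by fun_prop)), Measure.prod_restrict,
    ← lintegral_indicator (hA.prod hB)]
  refine lintegral_congr fun p => ?_
  by_cases hp : p.1 ∈ A ∧ p.2 ∈ B
  · simpa [hS_def, hp.1, hp.2, indicator] using hΦ.measure_mem_cell_and_mem_cell p.1 p.2
  · have h0 : (fun ω => (ω, p)) ⁻¹' S = ∅ := by
      ext ω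
      simp only [hS_def, mem_preimage, mem_ofPred_eq, mem_empty_iff_false, iff_false]
      tauto
    rw [h0, measure_empty, indicator_of_notMem]
    exact hp

/-- The union of two balls has at least the mean of their volumes, so the double integral is
dominated by a product of convergent integrals. -/
theorem lintegral_sq_volume_inter_cell_lt_top (hd : 1 ≤ d) (hlam : 0 < lam)
    (hΦ : IsPoissonProcess Φ lam P) (A : Set (EuclideanSpace ℝ (Fin d))) :
    ∫⁻ ω, volume (A ∩ cell (Φ ω)) * volume (A ∩ cell (Φ ω)) ∂P < ∞ := by
  have hlam' : (0 : ℝ) < lam := hlam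
  have hκ := kappa_pos d
  set b : EuclideanSpace ℝ (Fin d) → ℝ≥0∞ := fun y =>
    ENNReal.ofReal (Real.exp (-(lam / 2 * kappa d * ‖y‖ ^ d)))
  have hb : ∫⁻ y, b y < ∞ := by
    have := (integrable_exp_neg_norm_pow hd (c := lam / 2 * kappa d)
      (by positivity)).lintegral_lt_top
    exact this
  have hbm : Measurable b := by fun_prop
  calc ∫⁻ ω, volume (A ∩ cell (Φ ω)) * volume (A ∩ cell (Φ ω)) ∂P
      ≤ ∫⁻ ω, volume (univ ∩ cell (Φ ω)) * volume (univ ∩ cell (Φ ω)) ∂P := by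
        gcongr <;> exact subset_univ _
    _ = ∫⁻ y : EuclideanSpace ℝ (Fin d), ∫⁻ z,
          ENNReal.ofReal (Real.exp (-(lam * unionVol y z))) := by
        rw [hΦ.lintegral_volume_inter_cell_mul MeasurableSet.univ MeasurableSet.univ]
        simp
    _ ≤ ∫⁻ y, ∫⁻ z, b y * b z := by
        gcongr with y z
        rw [← ENNReal.ofReal_mul (Real.exp_pos _).le, ← Real.exp_add]
        gcongr
        have h1 := le_unionVol hd y z
        have h2 := le_unionVol hd z y
        rw [unionVol_comm] at h2
        nlinarith
    _ = (∫⁻ y, b y) * ∫⁻ z, b z := by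
        simp_rw [lintegral_const_mul _ hbm]
        rw [lintegral_mul_const _ hbm]
    _ < ∞ := ENNReal.mul_lt_top hb hb

theorem memLp_volume_inter_cell (hd : 1 ≤ d) (hlam : 0 < lam) (hΦ : IsPoissonProcess Φ lam P)
    {A : Set (EuclideanSpace ℝ (Fin d))} (hA : MeasurableSet A) :
    MemLp (fun ω => volume.real (A ∩ cell (Φ ω))) 2 P := by
  have hm := measurable_volume_inter_cell hΦ.measurable_count hA
  refine (memLp_two_iff_integrable_sq hm.ennreal_toReal.aestronglyMeasurable).2 ?_
  have := integrable_toReal_of_lintegral_ne_top (hm.mul hm).aemeasurable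
    (hΦ.lintegral_sq_volume_inter_cell_lt_top hd hlam A).ne
  simpa [measureReal_def, sq] using this

theorem ae_volume_inter_cell_lt_top (hd : 1 ≤ d) (hlam : 0 < lam) (hΦ : IsPoissonProcess Φ lam P)
    {A : Set (EuclideanSpace ℝ (Fin d))} (hA : MeasurableSet A) :
    ∀ᵐ ω ∂P, volume (A ∩ cell (Φ ω)) < ∞ := by
  have hm := measurable_volume_inter_cell hΦ.measurable_count hA
  filter_upwards [ae_lt_top (hm.mul hm)
    (hΦ.lintegral_sq_volume_inter_cell_lt_top hd hlam A).ne] with ω hω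
  by_contra h
  simp [not_lt_top_iff.1 h] at hω

theorem integral_volume_inter_cell (hd : 1 ≤ d) (hlam : 0 < lam) (hΦ : IsPoissonProcess Φ lam P)
    {A : Set (EuclideanSpace ℝ (Fin d))} (hA : MeasurableSet A) :
    ∫ ω, volume.real (A ∩ cell (Φ ω)) ∂P =
      ∫ y in A, Real.exp (-(lam * (kappa d * ‖y‖ ^ d))) := by
  rw [integral_eq_lintegral_of_nonneg_ae (ae_of_all _ fun y => (Real.exp_pos _).le)
    (Continuous.aestronglyMeasurable (by fun_prop)), ← hΦ.lintegral_volume_inter_cell hd hA]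
  exact integral_toReal (measurable_volume_inter_cell hΦ.measurable_count hA).aemeasurable
    (hΦ.ae_volume_inter_cell_lt_top hd hlam hA)

theorem integral_volume_cell (hd : 1 ≤ d) (hlam : 0 < lam) (hΦ : IsPoissonProcess Φ lam P) :
    ∫ ω, volume.real (cell (Φ ω)) ∂P = (lam : ℝ)⁻¹ := by
  have h := hΦ.integral_volume_inter_cell hd hlam MeasurableSet.univ
  simp only [univ_inter, setIntegral_univ] at h
  exact h.trans (integral_exp_neg_norm_pow hd (NNReal.coe_pos.2 hlam))

theorem integral_volume_inter_cell_mul (hd : 1 ≤ d) (hlam : 0 < lam)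
    (hΦ : IsPoissonProcess Φ lam P) {A : Set (EuclideanSpace ℝ (Fin d))} (hA : MeasurableSet A) :
    ∫ ω, volume.real (A ∩ cell (Φ ω)) * volume.real (cell (Φ ω)) ∂P =
      ∫ y in A, unionMoment lam 0 y := by
  have hlam' : (0 : ℝ) < lam := hlam
  have hmeas := measurable_unionVol (d := d)
  have hM : AEStronglyMeasurable (unionMoment (d := d) lam 0) (volume.restrict A) := by
    have : Measurable fun p : EuclideanSpace ℝ (Fin d) × EuclideanSpace ℝ (Fin d) =>
        unionVol p.1 p.2 ^ 0 * Real.exp (-(lam * unionVol p.1 p.2)) := by fun_prop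
    exact this.stronglyMeasurable.integral_prod_right.aestronglyMeasurable
  have hM₀ : ∀ y : EuclideanSpace ℝ (Fin d), 0 ≤ unionMoment lam 0 y := fun y =>
    integral_nonneg fun z => by positivity
  have hA' := measurable_volume_inter_cell hΦ.measurable_count hA
  have hU := measurable_volume_inter_cell hΦ.measurable_count (A := univ) MeasurableSet.univ
  rw [integral_eq_lintegral_of_nonneg_ae (ae_of_all _ hM₀) hM]
  have h : ∀ y : EuclideanSpace ℝ (Fin d), ENNReal.ofReal (unionMoment lam 0 y) =
      ∫⁻ z in univ, ENNReal.ofReal (Real.exp (-(lam * unionVol y z))) := by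
    intro y
    have := integrable_unionVol_pow_mul_exp hd y hlam' 0
    rw [unionMoment, ofReal_integral_eq_lintegral_ofReal this (ae_of_all _ fun z => by positivity)]
    simp
  simp_rw [h, ← hΦ.lintegral_volume_inter_cell_mul hA MeasurableSet.univ]
  refine Eq.trans ?_ (integral_toReal (hA'.mul hU).aemeasurable ?_)
  · simp [measureReal_def]
  · filter_upwards [hΦ.ae_volume_inter_cell_lt_top hd hlam hA,
      hΦ.ae_volume_inter_cell_lt_top hd hlam MeasurableSet.univ] with ω h1 h2
    exact ENNReal.mul_lt_top h1 h2

end IsPoissonProcess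

/-- If the volume of the cell is infinite or zero, the conditional measure and the quotient are
both `0`, so that they agree for every `ω` and not only almost surely. -/
theorem IsUniformInCell.cdf_norm [IsProbabilityMeasure P] {Y : Ω → EuclideanSpace ℝ (Fin d)}
    (hY : IsUniformInCell Y Φ P) (hΦ : IsPoissonProcess Φ lam P) (r : ℝ) :
    cdf (P.map fun ω => ‖Y ω‖) r = ∫ ω, ballCellVol Φ r ω / cellVol Φ ω ∂P := by
  have hm : Measurable fun ω => ‖Y ω‖ := hY.measurable.norm
  have := Measure.isProbabilityMeasure_map (μ := P) hm.aemeasurable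
  have hle : sigmaOf Φ ≤ ‹MeasurableSpace Ω› :=
    iSup_le fun A => (hΦ.measurable_count A.1 A.2).comap_le
  have hA : MeasurableSet (Y ⁻¹' Metric.closedBall 0 r) := hY.measurable measurableSet_closedBall
  have hpre : (fun ω => ‖Y ω‖) ⁻¹' Iic r = Y ⁻¹' Metric.closedBall 0 r := by
    ext ω
    simp
  rw [cdf_eq_real, map_measureReal_apply hm measurableSet_Iic, hpre]
  have h := integral_condExp (μ := P) (f := (Y ⁻¹' Metric.closedBall 0 r).indicator 1) hle (E := ℝ)
  rw [integral_indicator_one hA] at h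
  rw [← h]
  refine integral_congr_ae ((hY.condProb _ measurableSet_closedBall).trans (ae_of_all _ fun ω => ?_))
  simp only [ballCellVol, cellVol]
  rw [measureReal_def, cond_apply (isClosed_cell _).measurableSet, inter_comm, div_eq_inv_mul,
    ENNReal.toReal_mul, ENNReal.toReal_inv]
  rfl

end Poisson

/-! ### The second-order expansion of a ratio -/

section Taylor

theorem hasFDerivAt_fst_div_snd {p : ℝ × ℝ} (hp : p.2 ≠ 0) :
    HasFDerivAt (fun z : ℝ × ℝ => z.1 / z.2)
      (p.2⁻¹ • ContinuousLinearMap.fst ℝ ℝ ℝ -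
        (p.1 / p.2 ^ 2) • ContinuousLinearMap.snd ℝ ℝ ℝ) p := by
  have h1 : HasFDerivAt (fun z : ℝ × ℝ => z.2⁻¹) _ p :=
    (hasDerivAt_inv hp).comp_hasFDerivAt p (hasFDerivAt_snd (𝕜 := ℝ))
  have h2 := (hasFDerivAt_fst (𝕜 := ℝ) (p := p)).fun_mul h1
  simp_rw [div_eq_mul_inv]
  refine h2.congr_fderiv ?_
  ext <;> simp

theorem taylorTwo_fst_div_snd {p : ℝ × ℝ} (hp : p.2 ≠ 0) (z : ℝ × ℝ) :
    taylorTwo (fun z => z.1 / z.2) p z =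
      p.1 / p.2 + ((z.1 - p.1) / p.2 - p.1 / p.2 ^ 2 * (z.2 - p.2)) +
        (-((z.1 - p.1) * (z.2 - p.2) / p.2 ^ 2) + p.1 / p.2 ^ 3 * (z.2 - p.2) ^ 2) := by
  have hev : fderiv ℝ (fun z : ℝ × ℝ => z.1 / z.2) =ᶠ[𝓝 p] fun q =>
      q.2⁻¹ • ContinuousLinearMap.fst ℝ ℝ ℝ -
        (q.1 / q.2 ^ 2) • ContinuousLinearMap.snd ℝ ℝ ℝ := by
    filter_upwards [continuous_snd.continuousAt.eventually_ne hp] with q hq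
    exact (hasFDerivAt_fst_div_snd hq).fderiv
  have h1 : HasFDerivAt (fun z : ℝ × ℝ => z.2⁻¹) _ p :=
    (hasDerivAt_inv hp).comp_hasFDerivAt p (hasFDerivAt_snd (𝕜 := ℝ))
  have h2 : HasFDerivAt (fun z : ℝ × ℝ => z.1 / z.2 ^ 2)
      ((p.2 ^ 2)⁻¹ • ContinuousLinearMap.fst ℝ ℝ ℝ -
        (2 * p.1 / p.2 ^ 3) • ContinuousLinearMap.snd ℝ ℝ ℝ) p := by
    have h3 := (hasFDerivAt_fst (𝕜 := ℝ) (p := p)).fun_mul (h1.fun_mul h1)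
    refine (h3.congr_fderiv ?_).congr_of_eventuallyEq (Eventually.of_forall fun q => ?_)
    · ext
      · simp [sq]
      · simp
        field_simp
        ring
    · simp [div_eq_mul_inv, sq]
  have h4 := (h1.smul_const (ContinuousLinearMap.fst ℝ ℝ ℝ)).fun_sub
    (h2.smul_const (ContinuousLinearMap.snd ℝ ℝ ℝ))
  rw [taylorTwo, hev.fderiv_eq, (hasFDerivAt_fst_div_snd hp).fderiv, h4.fderiv]
  simp
  field_simp
  ring

theorem deltaRatio_eq {Ω : Type*} [MeasurableSpace Ω] {P : Measure Ω} [IsProbabilityMeasure P]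
    {Z₁ Z₂ : Ω → ℝ} (h₁ : MemLp Z₁ 2 P) (h₂ : MemLp Z₂ 2 P) (h0 : ∫ ω, Z₂ ω ∂P ≠ 0) :
    deltaRatio P Z₁ Z₂ = (∫ ω, Z₁ ω ∂P) / (∫ ω, Z₂ ω ∂P) -
      cov[Z₁, Z₂; P] / (∫ ω, Z₂ ω ∂P) ^ 2 +
      (∫ ω, Z₁ ω ∂P) * Var[Z₂; P] / (∫ ω, Z₂ ω ∂P) ^ 3 := by
  rw [variance_eq_integral h₂.aemeasurable, covariance]
  simp only [deltaRatio, taylorTwo_fst_div_snd (p := (_, _)) h0]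
  set a := ∫ ω, Z₁ ω ∂P with ha
  set b := ∫ ω, Z₂ ω ∂P with hb
  have hX : MemLp (fun ω => Z₁ ω - a) 2 P := h₁.sub (memLp_const a)
  have hY : MemLp (fun ω => Z₂ ω - b) 2 P := h₂.sub (memLp_const b)
  have hXi := hX.integrable one_le_two
  have hYi := hY.integrable one_le_two
  have hXY : Integrable (fun ω => (Z₁ ω - a) * (Z₂ ω - b)) P := hX.integrable_mul hY
  have hX0 : ∫ ω, (Z₁ ω - a) ∂P = 0 := by
    rw [integral_sub (h₁.integrable one_le_two) (integrable_const a)]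
    simp [ha]
  have hY0 : ∫ ω, (Z₂ ω - b) ∂P = 0 := by
    rw [integral_sub (h₂.integrable one_le_two) (integrable_const b)]
    simp [hb]
  rw [integral_add, integral_add, integral_sub, integral_add, integral_neg,
    integral_div b fun ω => Z₁ ω - a, integral_div (b ^ 2), integral_const_mul,
    integral_const_mul, hX0, hY0]
  · simp
    ring
  · exact (hXY.div_const _).neg
  · exact hY.integrable_sq.const_mul _
  · exact hXi.div_const _
  · exact hYi.const_mul _
  · exact integrable_const _
  · exact (hXi.div_const _).sub (hYi.const_mul _)
  · exact (integrable_const _).add ((hXi.div_const _).sub (hYi.const_mul _))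
  · exact (hXY.div_const _).neg.add (hY.integrable_sq.const_mul _)

end Taylor

theorem iteratedDerivWithin_one_sub_exp {d : ℕ} (hd : 1 ≤ d) (c : ℝ) :
    iteratedDerivWithin d (fun r => 1 - Real.exp (-(c * r ^ d))) (Ici 0) 0 = d.factorial * c := by
  have hE : EulerRegular (d - 1) fun r : ℝ => Real.exp (-(c * r ^ d)) :=
    .of_contDiff (by fun_prop)
  have key := (hE.primitive (c := d * c) (F := fun r => 1 - Real.exp (-(c * r ^ d)))
    fun r _ => ?_).2
  · rw [Nat.sub_add_cancel hd] at key
    rw [key, ← Nat.mul_factorial_pred (by omega : d ≠ 0)]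
    simp [show d ≠ 0 by omega]
    ring
  · refine (((hasDerivAt_pow d r).const_mul c).fun_neg.exp.const_sub 1).hasDerivWithinAt.congr_deriv
      ?_
    ring

end PoissonVoronoi

/-! ### The correction factor -/

open Set in
theorem mainTheorem2 {Ω : Type*} [MeasurableSpace Ω] (P : Measure Ω) [IsProbabilityMeasure P]
    (d : ℕ) (hd : 1 ≤ d) (lam : ℝ≥0) (hlam : 0 < lam)
    (Φ : Ω → Set (EuclideanSpace ℝ (Fin d))) (hΦ : PoissonVoronoi.IsPoissonProcess Φ lam P)
    (Y : Ω → EuclideanSpace ℝ (Fin d)) (hY : PoissonVoronoi.IsUniformInCell Y Φ P) :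
    -- the moments involved are finite
    (MemLp (PoissonVoronoi.cellVol Φ) 2 P ∧ 0 < ∫ ω, PoissonVoronoi.cellVol Φ ω ∂P ∧
      ∀ r : ℝ, MemLp (PoissonVoronoi.ballCellVol Φ r) 2 P) ∧
    -- the exact CDF of `R_o = ‖Y‖` as the mean of a ratio
    (∀ r : ℝ, cdf (P.map (fun ω => ‖Y ω‖)) r =
      ∫ ω, PoissonVoronoi.ballCellVol Φ r ω / PoissonVoronoi.cellVol Φ ω ∂P) ∧
    -- the covariance has `d` derivatives on `[0, ∞)`, and the `d`-th one vanishes at `0`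
    (ContDiffOn ℝ d
        (fun r => cov[PoissonVoronoi.ballCellVol Φ r, PoissonVoronoi.cellVol Φ; P]) (Set.Ici 0) ∧
      iteratedDerivWithin d
        (fun r => cov[PoissonVoronoi.ballCellVol Φ r, PoissonVoronoi.cellVol Φ; P])
        (Set.Ici 0) 0 = 0) ∧
    -- the second-order expansion of the CDF has `d` derivatives on `[0, ∞)`
    ContDiffOn ℝ d
      (fun r => PoissonVoronoi.deltaRatio P (PoissonVoronoi.ballCellVol Φ r)
        (PoissonVoronoi.cellVol Φ)) (Set.Ici 0) ∧
    -- the `d`-th derivatives at `0` match for exactly one correction factor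
    ∀ ρ : ℝ,
      iteratedDerivWithin d
          (fun r => 1 - Real.exp (-(ρ * lam * PoissonVoronoi.kappa d * r ^ d))) (Set.Ici 0) 0 =
        iteratedDerivWithin d
          (fun r => PoissonVoronoi.deltaRatio P (PoissonVoronoi.ballCellVol Φ r)
            (PoissonVoronoi.cellVol Φ)) (Set.Ici 0) 0 ↔
      ρ = 1 + Var[PoissonVoronoi.cellVol Φ; P] / (∫ ω, PoissonVoronoi.cellVol Φ ω ∂P) ^ 2 := by
  open PoissonVoronoi in
  have hlam' : (0 : ℝ) < lam := hlam
  have hκ := kappa_pos d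
  have hZ : MemLp (cellVol Φ) 2 P := by
    have := hΦ.memLp_volume_inter_cell hd hlam MeasurableSet.univ
    simp only [univ_inter] at this
    exact this
  have hB : ∀ r : ℝ, MemLp (ballCellVol Φ r) 2 P := fun r =>
    hΦ.memLp_volume_inter_cell hd hlam measurableSet_closedBall
  have hm : ∫ ω, cellVol Φ ω ∂P = (lam : ℝ)⁻¹ := hΦ.integral_volume_cell hd hlam
  have hm₀ : ∫ ω, cellVol Φ ω ∂P ≠ 0 := hm ▸ (inv_pos.2 hlam').ne'
  set g : ℝ → ℝ := fun s => Real.exp (-(lam * (kappa d * s ^ d))) with hg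
  set e : EuclideanSpace ℝ (Fin d) := EuclideanSpace.single ⟨0, hd⟩ 1
  have he : ‖e‖ = 1 := by simp [e]
  set h : ℝ → ℝ := fun s => unionMoment lam 0 (s • e)
  set M : ℝ → ℝ := fun r => ∫ y in Metric.closedBall (0 : EuclideanSpace ℝ (Fin d)) r, g ‖y‖
  set C : ℝ → ℝ := fun r => ∫ y in Metric.closedBall (0 : EuclideanSpace ℝ (Fin d)) r, h ‖y‖
  have hM : ∀ r, ∫ ω, ballCellVol Φ r ω ∂P = M r := fun r =>
    hΦ.integral_volume_inter_cell hd hlam measurableSet_closedBall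
  have hC : ∀ r, ∫ ω, (ballCellVol Φ r * cellVol Φ) ω ∂P = C r := by
    intro r
    refine (hΦ.integral_volume_inter_cell_mul hd hlam measurableSet_closedBall).trans ?_
    refine integral_congr_ae (ae_of_all _ fun y => ?_)
    exact unionMoment_eq_of_norm_eq _ _ (by simp [norm_smul, he])
  have hcov : (fun r => cov[ballCellVol Φ r, cellVol Φ; P]) =
      fun r => C r + -(lam : ℝ)⁻¹ * M r := by
    funext r
    rw [covariance_eq_sub (hB r) hZ, hC, hM, hm]
    ring
  have hg₀ : EulerRegular (d - 1) g := .of_contDiff (by fun_prop)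
  obtain ⟨hM₁, hM₂⟩ := hg₀.setIntegral_closedBall hd
  obtain ⟨hC₁, hC₂⟩ := (eulerRegular_unionMoment hd hlam' (d - 1) 0 e).setIntegral_closedBall hd
  have hκ' : volume.real (Metric.ball (0 : EuclideanSpace ℝ (Fin d)) 1) = kappa d := by
    simpa using volume_real_ball hd (0 : EuclideanSpace ℝ (Fin d)) zero_le_one
  have hg0 : g 0 = 1 := by simp [hg, show d ≠ 0 by omega]
  rw [hκ', hg0, mul_one] at hM₂
  rw [hκ', zero_smul, unionMoment_zero_zero hd hlam'] at hC₂
  have hI := uniqueDiffOn_Ici (0 : ℝ)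
  have hM₁' := contDiffOn_const (c := -(lam : ℝ)⁻¹).mul hM₁
  have hcov₁ : ContDiffOn ℝ d (fun r => cov[ballCellVol Φ r, cellVol Φ; P]) (Ici 0) := by
    rw [hcov]
    exact hC₁.add hM₁'
  have hcov₂ : iteratedDerivWithin d (fun r => cov[ballCellVol Φ r, cellVol Φ; P]) (Ici 0) 0 =
      0 := by
    rw [hcov, iteratedDerivWithin_fun_add self_mem_Ici hI (hC₁ 0 self_mem_Ici)
      (hM₁' 0 self_mem_Ici),
      iteratedDerivWithin_const_mul self_mem_Ici hI _ (hM₁ 0 self_mem_Ici), hM₂, hC₂]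
    ring
  set V := Var[cellVol Φ; P]
  have hT : (fun r => deltaRatio P (ballCellVol Φ r) (cellVol Φ)) =
      fun r => (lam + V * lam ^ 3) * M r +
        -(lam : ℝ) ^ 2 * cov[ballCellVol Φ r, cellVol Φ; P] := by
    funext r
    rw [deltaRatio_eq (hB r) hZ hm₀, hM, hm]
    field_simp
    ring
  have hT₁ := contDiffOn_const (c := lam + V * lam ^ 3).mul hM₁
  have hT₂ := contDiffOn_const (c := -(lam : ℝ) ^ 2).mul hcov₁
  refine ⟨⟨hZ, hm ▸ inv_pos.2 hlam', hB⟩, hY.cdf_norm hΦ, ⟨hcov₁, hcov₂⟩, ?_, fun ρ => ?_⟩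
  · rw [hT]
    exact hT₁.add hT₂
  · rw [iteratedDerivWithin_one_sub_exp hd, hT,
      iteratedDerivWithin_fun_add self_mem_Ici hI (hT₁ 0 self_mem_Ici) (hT₂ 0 self_mem_Ici),
      iteratedDerivWithin_const_mul self_mem_Ici hI _ (hM₁ 0 self_mem_Ici),
      iteratedDerivWithin_const_mul self_mem_Ici hI _ (hcov₁ 0 self_mem_Ici), hcov₂, hM₂, hm]
    have hdf : (d.factorial : ℝ) ≠ 0 := by exact_mod_cast d.factorial_ne_zero
    have : (lam + V * lam ^ 3) * (d.factorial * kappa d) + -(lam : ℝ) ^ 2 * 0 =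
        d.factorial * ((1 + V / (lam : ℝ)⁻¹ ^ 2) * lam * kappa d) := by
      field_simp
      ring
    rw [this, mul_right_inj' hdf, mul_left_inj' hκ.ne', mul_left_inj' hlam'.ne']
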